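/- Let $k$ be an algebraically closed field of characteristic zero and let $(R,\mathfrak m)$ be an artinian Gorenstein local $k$-algebra that is not a field (Gorenstein meaning that $R$ has finite injective dimension as an $R$-module). If the length $\ell(R)$ of $R$ as an $R$-module is at most $7$, then $R$ is exact, that is, $$\sup\{\mu(\mathfrak a) : \mathfrak a \text{ an ideal of } R,\ \mathfrak a\subseteq\mathfrak m\}=\inf\{\ell(R/xR) : x\in\mathfrak m\},$$ where $\mu(\mathfrak a)$ denotes the minimal number of generators of $\mathfrak a$. -/

import Mathlib

/-- A noetherian local ring is Gorenstein if it has finite injective dimension as a module over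
itself. -/
def IsGorensteinLocalRing (R : Type*) [CommRing R] [IsLocalRing R] [IsNoetherianRing R] : Prop :=
  ∃ n : ℕ, CategoryTheory.HasInjectiveDimensionLE (ModuleCat.of R R) n

namespace IsLocalRing

/-- `μ(I)`, the minimal number of generators of an ideal. -/
noncomputable def minGenerators {R : Type*} [CommRing R] (I : Ideal R) : ℕ∞ :=
  Cardinal.toENat I.spanRank

/-- The Dilworth number `sup {μ(I) : I ⊆ 𝔪}`. -/
noncomputable def dilworthNumber (R : Type*) [CommRing R] [IsLocalRing R] : ℕ∞ :=
  ⨆ (I : Ideal R) (_ : I ≤ maximalIdeal R), minGenerators I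

/-- The Rees number `inf {ℓ(R / xR) : x ∈ 𝔪}`. -/
noncomputable def reesNumber (R : Type*) [CommRing R] [IsLocalRing R] : ℕ∞ :=
  ⨅ (x : R) (_ : x ∈ maximalIdeal R), Module.length R (R ⧸ Ideal.span {x})

/-- A local ring is exact if its Dilworth number equals its Rees number. -/
def IsExact (R : Type*) [CommRing R] [IsLocalRing R] : Prop :=
  dilworthNumber R = reesNumber R

end IsLocalRing

/-! For `x ∈ 𝔪` and any ideal `I`, `μ(I) ≤ ℓ(I/xI) = ℓ(0 :_I x) ≤ ℓ(R/xR)`. If `x ≠ 0` and `x𝔪 =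
𝔪²`, these are equalities for `I = 𝔪`, so `R` is exact (`isExact_of_span_mul_eq`). To find `x` when
`𝔪² ≠ 0`, the Gorenstein hypothesis enters only through the simple socle and its consequence `ℓ(I) +
ℓ(0 : I) = ℓ(R)`. Put `hᵢ = ℓ(𝔪ⁱ/𝔪ⁱ⁺¹)`. The cases `h₁ = 1` and `h₂ = 1` are direct, and duality
excludes `h₂ ≥ 3` otherwise. If `h₁ = h₂ = 2`, a pair of generators suffices. The remaining Hilbert
function is `(1, 3, 2, 1)`, where duality gives a generator `e` with `e𝔪 ⊆ 𝔪³`, which reduces to the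
pair case. -/

open CategoryTheory Abelian IsLocalRing

/-! ### Finite injective dimension forces a simple socle. -/

section SelfInjective

universe u

variable {R : Type u} [CommRing R] [IsLocalRing R]

/-- A nonzero socle element has the maximal ideal as its annihilator. -/
lemma IsLocalRing.ker_toSpanSingleton_of_mem_annihilator {s : R}
    (hs : s ∈ (maximalIdeal R).annihilator) (hs0 : s ≠ 0) :
    LinearMap.ker (LinearMap.toSpanSingleton R R s) = maximalIdeal R := by
  refine le_antisymm (le_maximalIdeal ?_) fun a ha ↦ ?_
  · rw [Ne, Ideal.eq_top_iff_one]
    simpa using hs0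
  · simpa [mul_comm] using Submodule.mem_annihilator.mp hs a ha

lemma IsLocalRing.maximalIdeal_le_jacobson_bot : maximalIdeal R ≤ Ideal.jacobson ⊥ :=
  (jacobson_eq_maximalIdeal ⊥ bot_ne_top).ge

variable [IsArtinianRing R]

lemma IsLocalRing.exists_maximalIdeal_pow_eq_bot : ∃ n, maximalIdeal R ^ n = ⊥ := by
  obtain ⟨n, hn⟩ := IsArtinianRing.isNilpotent_jacobson_bot (R := R)
  rw [jacobson_eq_maximalIdeal ⊥ bot_ne_top] at hn
  exact ⟨n, hn⟩

/-- An artinian local ring has a nonzero socle. -/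
lemma IsLocalRing.annihilator_maximalIdeal_ne_bot :
    (maximalIdeal R).annihilator ≠ ⊥ := by
  classical
  have hex : ∃ n, maximalIdeal R ^ n = ⊥ := exists_maximalIdeal_pow_eq_bot
  obtain ⟨k, hk⟩ : ∃ k, Nat.find hex = k + 1 := by
    refine Nat.exists_eq_succ_of_ne_zero fun h0 ↦ ?_
    have := Nat.find_spec hex
    rw [h0, pow_zero] at this
    exact one_ne_zero this
  have h1 : maximalIdeal R ^ k ≠ ⊥ := Nat.find_min hex (by omega)
  have h2 : maximalIdeal R ^ (k + 1) = ⊥ := hk ▸ Nat.find_spec hex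
  refine fun h ↦ h1 (le_bot_iff.mp (h ▸ ?_))
  rw [Submodule.le_annihilator_iff, smul_eq_mul, ← pow_succ, h2]

/-- Vanishing of `Ext^{i+1}(-, R)` on finite modules passes down to `Ext^i` for `i ≥ 1`, because
the residue field embeds into `R`. -/
lemma Ext_eq_zero_of_forall_succ (i : ℕ) (hi : i ≠ 0)
    (h : ∀ (M : Type u) [AddCommGroup M] [Module R M] [Module.Finite R M]
      (e : Ext (ModuleCat.of R M) (ModuleCat.of R R) (i + 1)), e = 0)
    (M : Type u) [AddCommGroup M] [Module R M] [hM : Module.Finite R M] :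
    ∀ e : Ext (ModuleCat.of R M) (ModuleCat.of R R) i, e = 0 := by
  induction hM using IsNoetherianRing.induction_on_isQuotientEquivQuotientPrime R with
  | subsingleton N =>
    intro e
    have hz : Limits.IsZero (ModuleCat.of R N) := ModuleCat.isZero_of_subsingleton _
    rw [← e.mk₀_id_comp, hz.eq_zero_of_src (𝟙 _), Ext.mk₀_zero, Ext.zero_comp]
  | quotient N p φ =>
    obtain ⟨s, hs, hs0⟩ := Submodule.exists_mem_ne_zero_of_ne_bot
      (annihilator_maximalIdeal_ne_bot (R := R))
    -- Primes are maximal here, so `N` is the residue field and embeds into `R` through the socle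
    -- element `s`.
    have hp : p.1 = maximalIdeal R := eq_maximalIdeal (IsArtinianRing.isMaximal_of_isPrime p.1)
    have hker : LinearMap.ker (LinearMap.toSpanSingleton R R s) = p.1 :=
      (ker_toSpanSingleton_of_mem_annihilator hs hs0).trans hp.symm
    let f : (R ⧸ p.1) →ₗ[R] R := Submodule.liftQ p.1 (LinearMap.toSpanSingleton R R s) hker.ge
    have hf : Function.Injective f :=
      LinearMap.ker_eq_bot.mp (Submodule.ker_liftQ_eq_bot _ _ _ hker.le)
    let g : N →ₗ[R] R := f ∘ₗ φ.toLinearMap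
    have hg : Function.Injective g := hf.comp φ.injective
    let S : ShortComplex (ModuleCat.{u} R) :=
      ModuleCat.shortComplexOfCompEqZero _ _ g.exact_map_mkQ_range.linearMap_comp_eq_zero
    have hS : S.ShortExact := ModuleCat.shortComplex_shortExact S
      g.exact_map_mkQ_range hg (Submodule.mkQ_surjective _)
    intro e
    -- `Ext^i(N, R)` sits between `Ext^i(R, R) = 0` and `Ext^{i+1}` of the cokernel, which vanishes
    -- by `h`.
    obtain ⟨e₂, rfl⟩ := Ext.contravariant_sequence_exact₁ hS _ e (add_comm 1 i) (h _ _)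
    obtain ⟨j, rfl⟩ := Nat.exists_eq_succ_of_ne_zero hi
    have : Projective (ModuleCat.of R R) := 
      ModuleCat.projective_of_free (Module.Basis.singleton Unit R)
    have : e₂ = 0 := Ext.eq_zero_of_projective (P := ModuleCat.of R R) e₂
    rw [this, Ext.comp_zero]
  | exact N₁ N₂ N₃ f g hf hg hfg h₁ h₃ =>
    let S : ShortComplex (ModuleCat.{u} R) :=
      ModuleCat.shortComplexOfCompEqZero _ _ hfg.linearMap_comp_eq_zero
    have hS : S.ShortExact := ModuleCat.shortComplex_shortExact S hfg hf hg
    intro e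
    obtain ⟨e₃, rfl⟩ := Ext.contravariant_sequence_exact₂ hS _ e (h₁ _)
    rw [h₃ e₃, Ext.comp_zero]

/-- Descend from degree `n + 1`, where the injective dimension gives vanishing, one degree at a
time. -/
lemma IsGorensteinLocalRing.ext_one_eq_zero (hR : IsGorensteinLocalRing R)
    (M : Type u) [AddCommGroup M] [Module R M] [Module.Finite R M]
    (e : Ext (ModuleCat.of R M) (ModuleCat.of R R) 1) : e = 0 := by
  obtain ⟨n, hn⟩ := hR
  have key : ∀ k ≤ n, ∀ (M : Type u) [AddCommGroup M] [Module R M] [Module.Finite R M]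
      (e : Ext (ModuleCat.of R M) (ModuleCat.of R R) (n - k + 1)), e = 0 := by
    intro k
    induction k with
    | zero => exact fun _ M _ _ _ e ↦ e.eq_zero_of_hasInjectiveDimensionLT (n + 1) le_rfl
    | succ k ih =>
      intro hk M _ _ _
      refine Ext_eq_zero_of_forall_succ _ (by omega) ?_ M
      have := ih (by omega)
      rwa [show n - k + 1 = n - (k + 1) + 1 + 1 by omega] at this
  have := key n le_rfl M
  rw [Nat.sub_self] at this
  exact this e

/-- The socle of an artinian Gorenstein local ring is generated by each of its nonzero elements. -/
lemma IsGorensteinLocalRing.mem_span_of_mem_annihilator (hR : IsGorensteinLocalRing R) {s t : R}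
    (hs : s ∈ (maximalIdeal R).annihilator) (ht : t ∈ (maximalIdeal R).annihilator)
    (hs0 : s ≠ 0) : t ∈ Ideal.span {s} := by
  have hle {r : R} (hr : r ∈ (maximalIdeal R).annihilator) :
      maximalIdeal R ≤ LinearMap.ker (LinearMap.toSpanSingleton R R r) := fun a ha ↦ by
    simpa [mul_comm] using Submodule.mem_annihilator.mp hr a ha
  let f : (R ⧸ maximalIdeal R) →ₗ[R] R := Submodule.liftQ _ _ (hle hs)
  let g : (R ⧸ maximalIdeal R) →ₗ[R] R := Submodule.liftQ _ _ (hle ht)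
  have hf : Function.Injective f :=
    LinearMap.ker_eq_bot.mp (Submodule.ker_liftQ_eq_bot _ _ _
      (ker_toSpanSingleton_of_mem_annihilator hs hs0).le)
  let S : ShortComplex (ModuleCat.{u} R) :=
    ModuleCat.shortComplexOfCompEqZero _ _ f.exact_map_mkQ_range.linearMap_comp_eq_zero
  have hS : S.ShortExact := ModuleCat.shortComplex_shortExact S
    f.exact_map_mkQ_range hf (Submodule.mkQ_surjective _)
  -- As `Ext¹` of the cokernel of `f` vanishes, `g` extends along `f` to an endomorphism `c` of `R`,
  -- and `c` sends `s` to `t`.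
  obtain ⟨e, he⟩ := Ext.contravariant_sequence_exact₁ hS _
    (Ext.mk₀ (ModuleCat.ofHom g)) (add_zero 1) (hR.ext_one_eq_zero _ _)
  obtain ⟨c, rfl⟩ := (Ext.mk₀_bijective _ _).2 e
  rw [Ext.mk₀_comp_mk₀] at he
  have hc := congrArg (fun φ ↦ φ.hom (Submodule.Quotient.mk 1)) ((Ext.mk₀_bijective _ _).1 he)
  have hf1 : f (Submodule.Quotient.mk 1) = s := by
    rw [Submodule.liftQ_apply, LinearMap.toSpanSingleton_apply, one_smul]
  have hg1 : g (Submodule.Quotient.mk 1) = t := by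
    rw [Submodule.liftQ_apply, LinearMap.toSpanSingleton_apply, one_smul]
  have hc' : c.hom s = t := by
    rw [← hf1, ← hg1]
    exact hc
  refine Ideal.mem_span_singleton'.mpr ⟨c.hom (1 : R), ?_⟩
  rw [← hc', mul_comm, ← smul_eq_mul, ← map_smul, smul_eq_mul, mul_one]

end SelfInjective

/-! ### Lengths of ideals, and the criterion `x𝔪 = 𝔪²`. -/

section IdealLength

variable {R : Type*} [CommRing R]

/-- The length of an ideal of an artinian ring, as a natural number. -/
noncomputable def Ideal.len (I : Ideal R) : ℕ := (Module.length R I).toNat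

@[simp] lemma Ideal.len_bot : (⊥ : Ideal R).len = 0 := by simp [Ideal.len]

lemma LinearMap.range_lsmul_self (x : R) :
    LinearMap.range (LinearMap.lsmul R R x) = Ideal.span {x} := by
  ext y
  simp [Ideal.mem_span_singleton', mul_comm]

variable [IsArtinianRing R]

lemma Ideal.coe_len (I : Ideal R) : (I.len : ℕ∞) = Module.length R I :=
  ENat.natCast_toNat Module.length_ne_top

lemma Ideal.len_strictMono : StrictMono (Ideal.len (R := R)) := fun I J h ↦ by
  rw [← Nat.cast_lt (α := ℕ∞), coe_len, coe_len, Module.length_submodule, Module.length_submodule]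
  exact Submodule.height_strictMono h

lemma Ideal.len_mono : Monotone (Ideal.len (R := R)) := Ideal.len_strictMono.monotone

lemma Ideal.eq_of_le_of_len_le {I J : Ideal R} (h : I ≤ J) (hl : J.len ≤ I.len) : I = J :=
  h.eq_or_lt.resolve_right fun hlt ↦ (Ideal.len_strictMono hlt).not_ge hl

lemma Ideal.len_pos {I : Ideal R} (hI : I ≠ ⊥) : 0 < I.len := by
  simpa using Ideal.len_strictMono (bot_lt_iff_ne_bot.mpr hI)

lemma Ideal.coe_len_top : ((⊤ : Ideal R).len : ℕ∞) = Module.length R R := by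
  rw [coe_len, Module.length_top]

/-- If multiplication by `f` maps `K` into `S` and its kernel on `K` lies in `K'`, then
`ℓ(K) ≤ ℓ(K') + ℓ(S)`. -/
lemma Ideal.len_le_add_of_mul_mem {K K' S : Ideal R} (f : R) (hS : ∀ a ∈ K, a * f ∈ S)
    (hK : ∀ a ∈ K, a * f = 0 → a ∈ K') : K.len ≤ K'.len + S.len := by
  let φ : K →ₗ[R] S := ((LinearMap.mulRight R f).restrict hS)
  have h1 := Module.length_eq_add_of_exact (LinearMap.ker φ).subtype φ.rangeRestrict
    (Submodule.subtype_injective _) φ.surjective_rangeRestrict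
    (by rw [LinearMap.exact_iff]; simp)
  have h2 : Module.length R (LinearMap.range φ) ≤ Module.length R S :=
    Module.length_le_of_injective _ (Submodule.subtype_injective _)
  have hmem : ∀ a : LinearMap.ker φ, K.subtype ((LinearMap.ker φ).subtype a) ∈ K' := fun a ↦
    hK _ a.1.2 (congrArg Subtype.val a.2)
  have h3 : Module.length R (LinearMap.ker φ) ≤ Module.length R K' := by
    refine Module.length_le_of_injective
      ((K.subtype ∘ₗ (LinearMap.ker φ).subtype).codRestrict K' hmem) fun a b hab ↦ ?_
    exact Subtype.ext (Subtype.ext (congrArg (fun z ↦ z.1) hab :))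
  rw [← Nat.cast_le (α := ℕ∞), Nat.cast_add, coe_len, coe_len, coe_len, h1]
  exact add_le_add h3 h2

/-- An ideal `I` is generated over a subideal `J` by at most `ℓ(I) - ℓ(J)` elements. -/
lemma Ideal.exists_finset_span_sup_eq {J I : Ideal R} (hJI : J ≤ I) {n : ℕ}
    (hn : I.len ≤ J.len + n) : ∃ s : Finset R, s.card ≤ n ∧ Ideal.span s ⊔ J = I := by
  classical
  induction n generalizing J with
  | zero => exact ⟨∅, le_rfl, by simpa using Ideal.eq_of_le_of_len_le hJI hn⟩
  | succ n ih =>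
    obtain rfl | hlt := hJI.eq_or_lt
    · exact ⟨∅, by simp, by simp⟩
    obtain ⟨e, heI, heJ⟩ := SetLike.exists_of_lt hlt
    have hlt' : J < J ⊔ Ideal.span {e} := left_lt_sup.mpr (by simpa using heJ)
    have := Ideal.len_strictMono hlt'
    obtain ⟨s, hs, rfl⟩ := ih (J := J ⊔ Ideal.span {e})
      (sup_le hJI ((Ideal.span_singleton_le_iff_mem _).mpr heI)) (by omega)
    refine ⟨insert e s, (Finset.card_insert_le _ _).trans (by omega), ?_⟩
    rw [Finset.coe_insert, Ideal.span_insert, sup_comm J, sup_left_comm, sup_assoc]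

/-- The kernel and the cokernel of an endomorphism of a module of finite length have the same
length. -/
lemma Module.length_ker_eq_length_quotient_range {M : Type*} [AddCommGroup M] [Module R M]
    [Module.Finite R M] (f : M →ₗ[R] M) :
    Module.length R (LinearMap.ker f) = Module.length R (M ⧸ LinearMap.range f) := by
  have h1 := Module.length_eq_add_of_exact (LinearMap.ker f).subtype f.rangeRestrict
    (Submodule.subtype_injective _) f.surjective_rangeRestrict
    (by rw [LinearMap.exact_iff]; simp)
  have h2 := Module.length_eq_add_of_exact (LinearMap.range f).subtype (LinearMap.range f).mkQ
    (Submodule.subtype_injective _) (Submodule.mkQ_surjective _)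
    (by rw [LinearMap.exact_iff]; simp)
  rw [h1, add_comm] at h2
  exact ENat.add_right_injective_of_ne_top Module.length_ne_top h2

variable [IsLocalRing R]

lemma IsLocalRing.len_top : (⊤ : Ideal R).len = (maximalIdeal R).len + 1 := by
  have h := Module.length_eq_add_of_exact (maximalIdeal R).subtype (maximalIdeal R).mkQ
    (Submodule.subtype_injective _) (Submodule.mkQ_surjective _)
    (by rw [LinearMap.exact_iff]; simp)
  have : IsSimpleModule R (R ⧸ maximalIdeal R) :=
    isSimpleModule_iff_isCoatom.mpr (maximalIdeal.isMaximal R).out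
  rw [Module.length_eq_one (R := R) (M := R ⧸ maximalIdeal R)] at h
  rw [← Nat.cast_inj (R := ℕ∞), Nat.cast_add, Ideal.coe_len_top, Ideal.coe_len, h, Nat.cast_one]

lemma IsLocalRing.pow_succ_lt_pow {n : ℕ} (h : maximalIdeal R ^ n ≠ ⊥) :
    maximalIdeal R ^ (n + 1) < maximalIdeal R ^ n := by
  refine (Ideal.pow_le_pow_right n.le_succ).lt_of_ne fun heq ↦ h ?_
  refine Submodule.eq_bot_of_le_smul_of_le_jacobson_bot (maximalIdeal R) _
    (IsNoetherian.noetherian _) ?_ maximalIdeal_le_jacobson_bot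
  rw [smul_eq_mul, ← pow_succ', heq]

/-- Nakayama's lemma for the equality `x𝔪 = 𝔪²`. -/
lemma IsLocalRing.span_mul_maximalIdeal_eq {x : R} (hx : x ∈ maximalIdeal R)
    (h : maximalIdeal R ^ 2 ≤ Ideal.span {x} * maximalIdeal R ⊔ maximalIdeal R ^ 3) :
    Ideal.span {x} * maximalIdeal R = maximalIdeal R ^ 2 := by
  refine le_antisymm ?_ ?_
  · rw [sq]
    exact Ideal.mul_mono_left ((Ideal.span_singleton_le_iff_mem _).mpr hx)
  · refine Submodule.le_of_le_smul_of_le_jacobson_bot (IsNoetherian.noetherian _)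
      maximalIdeal_le_jacobson_bot (h.trans (sup_le_sup_left ?_ _))
    rw [smul_eq_mul, ← pow_succ']

/-- `μ(I) ≤ ℓ(I / 𝔪I)`. -/
lemma IsLocalRing.minGenerators_le {I : Ideal R} :
    minGenerators I ≤ Module.length R (I ⧸ (maximalIdeal R • ⊤ : Submodule R I)) := by
  have h := Module.length_eq_add_of_exact
    (Submodule.inclusion (Ideal.mul_le_right : maximalIdeal R * I ≤ I))
    (maximalIdeal R • ⊤ : Submodule R I).mkQ
    (Submodule.inclusion_injective _) (Submodule.mkQ_surjective _)
    (by
      rw [LinearMap.exact_iff, Submodule.ker_mkQ, Submodule.range_inclusion]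
      apply Submodule.map_injective_of_injective I.subtype_injective
      rw [Submodule.map_smul'', Submodule.map_top, Submodule.range_subtype,
        Submodule.map_comap_subtype, smul_eq_mul]
      exact (inf_eq_right.mpr Ideal.mul_le_right).symm)
  obtain ⟨n, hn⟩ := ENat.ne_top_iff_exists.mp
    (Module.length_ne_top (R := R) (M := I ⧸ (maximalIdeal R • ⊤ : Submodule R I)))
  rw [← hn, ← Ideal.coe_len, ← Ideal.coe_len, ← Nat.cast_add, Nat.cast_inj] at h
  obtain ⟨s, hs, hsI⟩ := Ideal.exists_finset_span_sup_eq Ideal.mul_le_right h.le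
  have hspan : Ideal.span (s : Set R) = I := by
    refine le_antisymm (le_sup_left.trans hsI.le) ?_
    exact Submodule.le_of_le_smul_of_le_jacobson_bot (IsNoetherian.noetherian _)
      maximalIdeal_le_jacobson_bot hsI.ge
  rw [← hn, minGenerators, Submodule.spanRank_toENat_eq_iInf_finset_card]
  exact (iInf_le _ ⟨s, hspan⟩).trans (by exact_mod_cast hs)

lemma IsLocalRing.minGenerators_maximalIdeal : minGenerators (maximalIdeal R) =
    Module.length R (maximalIdeal R ⧸ (maximalIdeal R • ⊤ : Submodule R (maximalIdeal R))) := by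
  rw [minGenerators, ← rank_cotangentSpace_eq_spanrank_maximalIdeal, ← Module.length_eq_rank,
    ← Module.length_eq_of_surjective (S := R) (R := ResidueField R) Ideal.Quotient.mk_surjective]
  rfl

/-- The Dilworth number of an artinian local ring is at most its Rees number. -/
lemma IsLocalRing.dilworthNumber_le_reesNumber : dilworthNumber R ≤ reesNumber R := by
  refine iSup₂_le fun I _ ↦ le_iInf₂ fun x hx ↦ minGenerators_le.trans ?_
  have hle : LinearMap.range (LinearMap.lsmul R I x) ≤ (maximalIdeal R • ⊤ : Submodule R I) := by
    rintro _ ⟨y, rfl⟩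
    exact Submodule.smul_mem_smul hx trivial
  calc Module.length R (I ⧸ (maximalIdeal R • ⊤ : Submodule R I))
    _ ≤ Module.length R (I ⧸ LinearMap.range (LinearMap.lsmul R I x)) :=
        Module.length_le_of_surjective (Submodule.factor hle) (Submodule.factor_surjective hle)
    _ = Module.length R (LinearMap.ker (LinearMap.lsmul R I x)) :=
        (Module.length_ker_eq_length_quotient_range _).symm
    _ ≤ Module.length R (LinearMap.ker (LinearMap.lsmul R R x)) := by
        refine Module.length_le_of_injective
          (I.subtype.restrict (p := LinearMap.ker (LinearMap.lsmul R I x)) fun a ha ↦ ?_)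
          fun a b hab ↦ Subtype.ext (Subtype.ext (congrArg (fun z ↦ z.1) hab :))
        exact congrArg Subtype.val ha
    _ = Module.length R (R ⧸ Ideal.span {x}) := by
        rw [Module.length_ker_eq_length_quotient_range, LinearMap.range_lsmul_self]

/-- An artinian local ring is exact if `x𝔪 = 𝔪²` for some nonzero `x ∈ 𝔪`. -/
lemma IsLocalRing.isExact_of_span_mul_eq {x : R} (hx : x ∈ maximalIdeal R) (hx0 : x ≠ 0)
    (h : Ideal.span {x} * maximalIdeal R = maximalIdeal R ^ 2) : IsExact R := by
  refine le_antisymm dilworthNumber_le_reesNumber ?_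
  have hrange : LinearMap.range (LinearMap.lsmul R (maximalIdeal R) x) =
      (maximalIdeal R • ⊤ : Submodule R (maximalIdeal R)) := by
    apply Submodule.map_injective_of_injective (maximalIdeal R).subtype_injective
    rw [Submodule.map_smul'', Submodule.map_top, Submodule.range_subtype, smul_eq_mul, ← sq, ← h]
    ext y
    simp only [Submodule.mem_map, LinearMap.mem_range, Ideal.mem_span_singleton_mul]
    exact ⟨fun ⟨_, ⟨z, hz⟩, hy⟩ ↦ ⟨z, z.2, by rw [← hy, ← hz]; rfl⟩,
      fun ⟨z, hz, hy⟩ ↦ ⟨_, ⟨⟨z, hz⟩, rfl⟩, hy⟩⟩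
  have hker : Module.length R (LinearMap.ker (LinearMap.lsmul R R x)) ≤
      Module.length R (LinearMap.ker (LinearMap.lsmul R (maximalIdeal R) x)) := by
    -- A unit cannot kill `x ≠ 0`, so the annihilator of `x` lies in `𝔪`.
    have hm : ∀ a ∈ LinearMap.ker (LinearMap.lsmul R R x), a ∈ maximalIdeal R := by
      intro a ha
      rw [mem_maximalIdeal, mem_nonunits_iff]
      intro hu
      exact hx0 ((hu.mul_left_eq_zero).mp ha)
    refine Module.length_le_of_injective
      (((LinearMap.ker (LinearMap.lsmul R R x)).subtype.codRestrict (maximalIdeal R)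
        fun a ↦ hm a a.2).codRestrict _ fun a ↦ Subtype.ext a.2)
      fun a b hab ↦ Subtype.ext (congrArg (fun z ↦ z.1.1) hab)
  calc reesNumber R ≤ Module.length R (R ⧸ Ideal.span {x}) := iInf₂_le x hx
    _ = Module.length R (LinearMap.ker (LinearMap.lsmul R R x)) := by
        rw [Module.length_ker_eq_length_quotient_range, LinearMap.range_lsmul_self]
    _ ≤ _ := hker
    _ = minGenerators (maximalIdeal R) := by
        rw [Module.length_ker_eq_length_quotient_range, hrange, minGenerators_maximalIdeal]
    _ ≤ dilworthNumber R := le_iSup₂ (f := fun (I : Ideal R) (_ : I ≤ maximalIdeal R) ↦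
        minGenerators I) (maximalIdeal R) le_rfl

end IdealLength

/-! ### Annihilator duality and the case analysis on Hilbert functions. -/

section ShortGorenstein

variable {R : Type*} [CommRing R] [IsLocalRing R] [IsArtinianRing R]

/-- A socle element of `I/J` is found in `𝔪ᵏe`, for the last `k` with `𝔪ᵏe ⊄ J`. -/
lemma IsLocalRing.exists_mem_notMem_forall_mul_mem {J I : Ideal R} (h : J < I) :
    ∃ f ∈ I, f ∉ J ∧ ∀ a ∈ maximalIdeal R, a * f ∈ J := by
  classical
  obtain ⟨e, heI, heJ⟩ := SetLike.exists_of_lt h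
  obtain ⟨n, hn⟩ := exists_maximalIdeal_pow_eq_bot (R := R)
  have hex : ∃ n, maximalIdeal R ^ n * Ideal.span {e} ≤ J := ⟨n, by simp [hn]⟩
  obtain ⟨k, hk⟩ : ∃ k, Nat.find hex = k + 1 := by
    refine Nat.exists_eq_succ_of_ne_zero fun h0 ↦ heJ ?_
    have := Nat.find_spec hex
    rw [h0, pow_zero, Ideal.one_eq_top, Ideal.top_mul] at this
    exact (Ideal.span_singleton_le_iff_mem _).mp this
  have h1 : ¬ maximalIdeal R ^ k * Ideal.span {e} ≤ J := Nat.find_min hex (by omega)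
  have h2 : maximalIdeal R ^ (k + 1) * Ideal.span {e} ≤ J := hk ▸ Nat.find_spec hex
  obtain ⟨f, hf, hfJ⟩ := SetLike.not_le_iff_exists.mp h1
  refine ⟨f, ?_, hfJ, fun a ha ↦ h2 ?_⟩
  · exact (Ideal.span_singleton_le_iff_mem _).mpr heI (Ideal.mul_le_right hf)
  · rw [pow_succ', mul_assoc]
    exact Ideal.mul_mem_mul ha hf

/-- The socle of an artinian Gorenstein local ring has length one. -/
lemma IsGorensteinLocalRing.len_annihilator_maximalIdeal (hR : IsGorensteinLocalRing R) :
    (maximalIdeal R).annihilator.len = 1 := by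
  have hatom : IsAtom (maximalIdeal R).annihilator := by
    refine ⟨annihilator_maximalIdeal_ne_bot, fun J hJ ↦ by_contra fun hJ0 ↦ hJ.not_ge fun t ht ↦ ?_⟩
    obtain ⟨s, hs, hs0⟩ := Submodule.exists_mem_ne_zero_of_ne_bot hJ0
    exact (Ideal.span_singleton_le_iff_mem _).mpr hs
      (hR.mem_span_of_mem_annihilator (hJ.le hs) ht hs0)
  have := isSimpleModule_iff_isAtom.mpr hatom
  rw [← Nat.cast_inj (R := ℕ∞), Ideal.coe_len, Module.length_eq_one, Nat.cast_one]

/-- Enlarge `J` by a socle element `f` of `I/J`: multiplication by `f` maps `0 : J` into the socle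
with kernel `0 : (J + (f))`, so the length drops by at most one. -/
lemma IsGorensteinLocalRing.len_annihilator_le (hR : IsGorensteinLocalRing R) {J I : Ideal R}
    (hJI : J ≤ I) {n : ℕ} (hn : I.len ≤ J.len + n) :
    J.annihilator.len ≤ I.annihilator.len + n := by
  induction n generalizing J with
  | zero => rw [Ideal.eq_of_le_of_len_le hJI hn]; rfl
  | succ n ih =>
    obtain rfl | hlt := hJI.eq_or_lt
    · omega
    obtain ⟨f, hfI, hfJ, hf⟩ := exists_mem_notMem_forall_mul_mem hlt
    have hlt' : J < J ⊔ Ideal.span {f} := left_lt_sup.mpr (by simpa using hfJ)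
    have h1 := Ideal.len_strictMono hlt'
    have h2 := ih (J := J ⊔ Ideal.span {f})
      (sup_le hJI ((Ideal.span_singleton_le_iff_mem _).mpr hfI)) (by omega)
    have h3 : J.annihilator.len ≤
        (J ⊔ Ideal.span {f}).annihilator.len + (maximalIdeal R).annihilator.len := by
      refine Ideal.len_le_add_of_mul_mem f (fun a ha ↦ ?_) fun a ha haf ↦ ?_
      · refine Submodule.mem_annihilator.mpr fun b hb ↦ ?_
        rw [smul_eq_mul, mul_assoc, mul_comm f]
        exact Submodule.mem_annihilator.mp ha _ (hf b hb)
      · rw [Submodule.annihilator_sup]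
        refine ⟨ha, ?_⟩
        simpa [Submodule.mem_annihilator_span_singleton] using haf
    rw [hR.len_annihilator_maximalIdeal] at h3
    omega

/-- In an artinian Gorenstein local ring, `ℓ(I) + ℓ(0 : I) = ℓ(R)`. -/
lemma IsGorensteinLocalRing.len_add_len_annihilator (hR : IsGorensteinLocalRing R) (I : Ideal R) :
    I.len + I.annihilator.len = (⊤ : Ideal R).len := by
  have h1 := hR.len_annihilator_le (bot_le (a := I)) (n := I.len) (by simp)
  have h2 := hR.len_annihilator_le (le_top (a := I)) (n := (⊤ : Ideal R).len - I.len) (by omega)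
  have h3 := Ideal.len_mono (le_top (a := I))
  rw [Submodule.annihilator_bot] at h1
  rw [show (⊤ : Ideal R).annihilator = ⊥ from Submodule.annihilator_top.trans
    (Module.annihilator_eq_bot.mpr inferInstance),
    Ideal.len_bot] at h2
  omega

/-- If `𝔪 = (a, b) + J` with `J𝔪 ⊆ 𝔪³` and `ℓ(𝔪² / 𝔪³) ≤ 2`, then one of `a`, `b`, `a + b` can be
taken for `x` in `x𝔪 = 𝔪²`. -/
lemma IsLocalRing.exists_span_mul_eq_of_span_pair {a b : R} {J : Ideal R}
    (hm : Ideal.span {a, b} ⊔ J = maximalIdeal R)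
    (hJ : J * maximalIdeal R ≤ maximalIdeal R ^ 3)
    (hlen : (maximalIdeal R ^ 2).len ≤ (maximalIdeal R ^ 3).len + 2) :
    ∃ x ∈ maximalIdeal R, Ideal.span {x} * maximalIdeal R = maximalIdeal R ^ 2 := by
  set m := maximalIdeal R with hmdef
  have ha : a ∈ m := hm ▸ Ideal.mem_sup_left (Ideal.subset_span (by simp))
  have hb : b ∈ m := hm ▸ Ideal.mem_sup_left (Ideal.subset_span (by simp))
  have hmem {x y : R} (hx : x ∈ m) (hy : y ∈ m) : x * y ∈ m ^ 2 := sq m ▸ Ideal.mul_mem_mul hx hy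
  have h32 : m ^ 3 ≤ m ^ 2 := Ideal.pow_le_pow_right (by norm_num)
  -- Modulo `𝔪³`, `J` contributes nothing to `𝔪²`.
  have hgen {N : Ideal R} (h3 : m ^ 3 ≤ N) (haa : a * a ∈ N) (hab : a * b ∈ N)
      (hbb : b * b ∈ N) : m ^ 2 ≤ N := by
    have hab' : Ideal.span {a, b} * Ideal.span {a, b} ≤ N := by
      rw [Ideal.span_mul_span', Ideal.span_le]
      rintro _ ⟨x, hx, y, hy, rfl⟩
      rcases hx with rfl | rfl <;> rcases hy with rfl | rfl
      exacts [haa, hab, (mul_comm y x ▸ hab : x * y ∈ N), hbb]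
    calc m ^ 2 = (Ideal.span {a, b} ⊔ J) * m := by rw [hm, sq]
      _ = Ideal.span {a, b} * (Ideal.span {a, b} ⊔ J) ⊔ J * m := by rw [Ideal.sup_mul, hm]
      _ ≤ N := by
        rw [Ideal.mul_sup]
        refine sup_le (sup_le hab' ?_) (hJ.trans h3)
        rw [mul_comm]
        exact (Ideal.mul_mono_right (le_sup_left.trans hm.le)).trans (hJ.trans h3)
  have hx {x y : R} (hx : x ∈ m) (hy : y ∈ m) : x * y ∈ Ideal.span {x} * m ⊔ m ^ 3 :=
    Ideal.mem_sup_left (Ideal.mul_mem_mul (Ideal.mem_span_singleton_self x) hy)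
  by_cases hq : a * b ∈ m ^ 3
  · refine ⟨a + b, add_mem ha hb, span_mul_maximalIdeal_eq (add_mem ha hb) ?_⟩
    have hq' := Ideal.mem_sup_right (S := Ideal.span {a + b} * m) hq
    refine hgen le_sup_right ?_ hq' ?_
    · have := sub_mem (hx (add_mem ha hb) ha) hq'
      rwa [show (a + b) * a - a * b = a * a by ring] at this
    · have := sub_mem (hx (add_mem ha hb) hb) hq'
      rwa [show (a + b) * b - a * b = b * b by ring] at this
  · have hlt : m ^ 3 < m ^ 3 ⊔ Ideal.span {a * b} := left_lt_sup.mpr (by simpa using hq)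
    have hl1 := Ideal.len_strictMono hlt
    -- Since `ℓ(𝔪²/𝔪³) ≤ 2`, `ab` and any `p` outside `𝔪³ + (ab)` generate `𝔪²` modulo `𝔪³`.
    have key {p x : R} (hxm : x ∈ m) (hp2 : p ∈ m ^ 2)
        (hpx : p ∈ Ideal.span {x} * m ⊔ m ^ 3) (hqx : a * b ∈ Ideal.span {x} * m ⊔ m ^ 3)
        (hpq : p ∉ m ^ 3 ⊔ Ideal.span {a * b}) : m ^ 2 ≤ Ideal.span {x} * m ⊔ m ^ 3 := by
      have hlt2 : m ^ 3 ⊔ Ideal.span {a * b} < m ^ 3 ⊔ Ideal.span {a * b} ⊔ Ideal.span {p} :=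
        left_lt_sup.mpr (by simpa using hpq)
      have hl2 := Ideal.len_strictMono hlt2
      rw [← Ideal.eq_of_le_of_len_le (I := m ^ 3 ⊔ Ideal.span {a * b} ⊔ Ideal.span {p})
        (J := m ^ 2) ?_ (by omega)]
      · simp only [sup_le_iff, Ideal.span_singleton_le_iff_mem]
        exact ⟨⟨le_sup_right, hqx⟩, hpx⟩
      · simp only [sup_le_iff, Ideal.span_singleton_le_iff_mem]
        exact ⟨⟨h32, hmem ha hb⟩, hp2⟩
    have hbx : a * b ∈ Ideal.span {b} * m ⊔ m ^ 3 := mul_comm b a ▸ hx hb ha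
    by_cases hp : a * a ∈ m ^ 3 ⊔ Ideal.span {a * b}
    · by_cases hr : b * b ∈ m ^ 3 ⊔ Ideal.span {a * b}
      · refine ⟨a, ha, span_mul_maximalIdeal_eq ha ?_⟩
        refine (hgen le_sup_left hp (Ideal.mem_sup_right (Ideal.mem_span_singleton_self _)) hr).trans
          (sup_le le_sup_right ((Ideal.span_singleton_le_iff_mem _).mpr (hx ha hb)))
      · exact ⟨b, hb, span_mul_maximalIdeal_eq hb (key hb (hmem hb hb) (hx hb hb) hbx hr)⟩
    · exact ⟨a, ha, span_mul_maximalIdeal_eq ha (key ha (hmem ha ha) (hx ha ha) (hx ha hb) hp)⟩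

/-- A version of `IsLocalRing.exists_span_mul_eq_of_span_pair` in terms of lengths. -/
lemma IsLocalRing.exists_span_mul_eq_of_len_le {J : Ideal R} (hJm : J ≤ maximalIdeal R)
    (hJlen : (maximalIdeal R).len ≤ J.len + 2)
    (hJ : J * maximalIdeal R ≤ maximalIdeal R ^ 3)
    (hlen : (maximalIdeal R ^ 2).len ≤ (maximalIdeal R ^ 3).len + 2) :
    ∃ x ∈ maximalIdeal R, Ideal.span {x} * maximalIdeal R = maximalIdeal R ^ 2 := by
  classical
  obtain ⟨s, hs, hsm⟩ := Ideal.exists_finset_span_sup_eq hJm hJlen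
  obtain ⟨a, b, hab⟩ : ∃ a b : R, Ideal.span (s : Set R) = Ideal.span {a, b} := by
    obtain h0 | h1 | h2 : s.card = 0 ∨ s.card = 1 ∨ s.card = 2 := by omega
    · exact ⟨0, 0, by simp [Finset.card_eq_zero.mp h0]⟩
    · obtain ⟨a, rfl⟩ := Finset.card_eq_one.mp h1
      exact ⟨a, a, by simp⟩
    · obtain ⟨a, b, -, rfl⟩ := Finset.card_eq_two.mp h2
      exact ⟨a, b, by simp⟩
  exact exists_span_mul_eq_of_span_pair (hab ▸ hsm) hJ hlen

/-- An artinian Gorenstein local ring of length at most seven satisfies `x𝔪 = 𝔪²` for some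
`x ∈ 𝔪`. -/
lemma IsGorensteinLocalRing.exists_span_mul_eq (hR : IsGorensteinLocalRing R)
    (hlen : (⊤ : Ideal R).len ≤ 7) (hm2 : maximalIdeal R ^ 2 ≠ ⊥) :
    ∃ x ∈ maximalIdeal R, Ideal.span {x} * maximalIdeal R = maximalIdeal R ^ 2 := by
  have htop := len_top (R := R)
  have hsoc := hR.len_annihilator_maximalIdeal
  have hann := hR.len_add_len_annihilator (maximalIdeal R ^ 2)
  have h32 : (maximalIdeal R ^ 3).len < (maximalIdeal R ^ 2).len :=
    Ideal.len_strictMono (pow_succ_lt_pow hm2)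
  set m := maximalIdeal R with hmdef
  have hm : m ≠ ⊥ := fun h ↦ hm2 (by rw [h]; simp)
  have h21 : (m ^ 2).len < m.len := by
    simpa using Ideal.len_strictMono (pow_succ_lt_pow (R := R) (n := 1) (by simpa using hm))
  -- the case `ℓ(𝔪² / 𝔪³) = 1`
  obtain h2 | h2 : (m ^ 2).len ≤ (m ^ 3).len + 1 ∨ (m ^ 3).len + 2 ≤ (m ^ 2).len := by omega
  · obtain ⟨x, hx, y, hy, hxy⟩ : ∃ x ∈ m, ∃ y ∈ m, x * y ∉ m ^ 3 := by
      by_contra! hcon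
      refine (pow_succ_lt_pow hm2).not_ge ?_
      rw [← hmdef, sq, Ideal.mul_le]
      exact hcon
    refine ⟨x, hx, span_mul_maximalIdeal_eq hx ?_⟩
    have hlt : m ^ 3 < m ^ 3 ⊔ Ideal.span {x * y} := left_lt_sup.mpr (by simpa using hxy)
    have := Ideal.len_strictMono hlt
    rw [← Ideal.eq_of_le_of_len_le (I := m ^ 3 ⊔ Ideal.span {x * y}) (J := m ^ 2) ?_ (by omega)]
    · refine sup_le le_sup_right ((Ideal.span_singleton_le_iff_mem _).mpr ?_)
      exact Ideal.mem_sup_left (Ideal.mul_mem_mul (Ideal.mem_span_singleton_self x) hy)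
    · refine sup_le (Ideal.pow_le_pow_right (by norm_num))
        ((Ideal.span_singleton_le_iff_mem _).mpr ?_)
      exact sq m ▸ Ideal.mul_mem_mul hx hy
  -- in all other cases `𝔪³ ≠ 0`
  have hm3 : m ^ 3 ≠ ⊥ := by
    intro h0
    have hle : m ^ 2 ≤ m.annihilator := by
      rw [Submodule.le_annihilator_iff, smul_eq_mul, ← pow_succ, h0]
    have := Ideal.len_mono hle
    omega
  have h3 := Ideal.len_pos hm3
  have h43 : (m ^ 4).len < (m ^ 3).len := Ideal.len_strictMono (pow_succ_lt_pow hm3)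
  -- the case `ℓ(𝔪 / 𝔪²) = 1`
  obtain h1 | h1 : m.len ≤ (m ^ 2).len + 1 ∨ (m ^ 2).len + 2 ≤ m.len := by omega
  · obtain ⟨e, he, he2⟩ := SetLike.exists_of_lt (pow_succ_lt_pow (R := R) (n := 1)
      (by simpa using hm))
    rw [pow_one] at he
    have hlt : m ^ 2 < m ^ 2 ⊔ Ideal.span {e} := left_lt_sup.mpr (by simpa using he2)
    have := Ideal.len_strictMono hlt
    have heq : m ^ 2 ⊔ Ideal.span {e} = m := Ideal.eq_of_le_of_len_le
      (sup_le (Ideal.pow_le_self (by norm_num)) ((Ideal.span_singleton_le_iff_mem _).mpr he))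
      (by omega)
    refine ⟨e, he, span_mul_maximalIdeal_eq he (le_of_eq ?_)⟩
    conv_lhs => rw [sq]; enter [1]; rw [← hmdef, ← heq]
    rw [Ideal.sup_mul, ← pow_succ, sup_comm]
  -- the case `ℓ(𝔪² / 𝔪³) ≥ 3` is impossible
  have hm4 (h : (m ^ 3).len = 1) : m ^ 4 = ⊥ := by
    by_contra h0
    have := Ideal.len_pos h0
    omega
  obtain h2' | h2' : (m ^ 2).len ≤ (m ^ 3).len + 2 ∨ (m ^ 3).len + 3 ≤ (m ^ 2).len := by omega
  swap
  -- The Hilbert function would be `(1, 2, 3, 1)`, so `𝔪⁴ = 0`; but `ℓ(𝔪²) = 4` while `ℓ(0 : 𝔪²) =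
  -- 3`.
  · have hle : m ^ 2 ≤ (m ^ 2).annihilator := by
      rw [Submodule.le_annihilator_iff, smul_eq_mul, ← pow_add, hm4 (by omega)]
    have := Ideal.len_mono hle
    omega
  obtain h1' | h1' : m.len ≤ (m ^ 2).len + 2 ∨ (m ^ 2).len + 3 ≤ m.len := by omega
  · exact exists_span_mul_eq_of_len_le (Ideal.pow_le_self (by norm_num)) h1' (pow_succ m 2).ge h2'
  -- the Hilbert function is `(1, 3, 2, 1)`
  have hsocle : m ^ 3 = m.annihilator := by
    refine Ideal.eq_of_le_of_len_le ?_ (by omega)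
    rw [Submodule.le_annihilator_iff, smul_eq_mul, ← pow_succ, hm4 (by omega)]
  -- By duality `ℓ(0 : 𝔪²) = 7 - 3 = 4 > ℓ(𝔪²)`.
  obtain ⟨e, he, hem2⟩ : ∃ e ∈ (m ^ 2).annihilator, e ∉ m ^ 2 := by
    refine SetLike.not_le_iff_exists.mp fun hle ↦ ?_
    have := Ideal.len_mono hle
    omega
  have hem : e ∈ m := le_maximalIdeal (fun h ↦ hm2 (Submodule.annihilator_eq_top_iff.mp h)) he
  have hlt : m ^ 2 < m ^ 2 ⊔ Ideal.span {e} := left_lt_sup.mpr (by simpa using hem2)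
  have := Ideal.len_strictMono hlt
  refine exists_span_mul_eq_of_len_le (J := m ^ 2 ⊔ Ideal.span {e})
    (sup_le (Ideal.pow_le_self (by norm_num)) ((Ideal.span_singleton_le_iff_mem _).mpr hem))
    (by rw [← hmdef]; omega) ?_ h2'
  rw [← hmdef, Ideal.sup_mul]
  refine sup_le (pow_succ m 2).ge ?_
  -- `e𝔪² = 0` puts `e𝔪` in the socle, which is `𝔪³`.
  rw [hsocle, Submodule.le_annihilator_iff, smul_eq_mul, mul_assoc, ← sq]
  refine Submodule.le_annihilator_iff.mp ?_
  exact (Ideal.span_singleton_le_iff_mem _).mpr he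

end ShortGorenstein

theorem mainTheorem5 (k : Type*) [Field k] [IsAlgClosed k] [CharZero k]
    (R : Type*) [CommRing R] [IsLocalRing R] [IsArtinianRing R] [Algebra k R]
    (hGor : IsGorensteinLocalRing R) (hfield : ¬ IsField R)
    (hlen : Module.length R R ≤ 7) :
    IsLocalRing.IsExact R := by
  have hlen' : (⊤ : Ideal R).len ≤ 7 := by
    rw [← Nat.cast_le (α := ℕ∞), Ideal.coe_len_top]
    exact hlen
  by_cases hm2 : maximalIdeal R ^ 2 = ⊥
  · obtain ⟨x, hx, hx0⟩ := Submodule.exists_mem_ne_zero_of_ne_bot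
      (fun h ↦ hfield (isField_iff_maximalIdeal_eq.mpr h))
    refine isExact_of_span_mul_eq hx hx0 (le_antisymm ?_ (hm2 ▸ bot_le))
    rw [sq]
    exact Ideal.mul_mono_left ((Ideal.span_singleton_le_iff_mem _).mpr hx)
  · obtain ⟨x, hx, h⟩ := hGor.exists_span_mul_eq hlen' hm2
    refine isExact_of_span_mul_eq hx (fun h0 ↦ hm2 ?_) h
    rw [← h, h0, Ideal.span_singleton_zero, Ideal.bot_mul]
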